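/- Let $G$ and $H$ be countable discrete groups. **Conventions.** A map $\varphi\colon G\to H$ is a *coarse map* if $\varphi^{-1}(\{y\})$ is finite for all $y\in H$ and, for every $S\subseteq G\times G$ such that $\{st^{-1}:(s,t)\in S\}$ is finite, $\{\varphi(s)\varphi(t)^{-1}:(s,t)\in S\}$ is finite. It is a *coarse embedding* if for every $S\subseteq G\times G$ the set $\{st^{-1}:(s,t)\in S\}$ is finite if and only if $\{\varphi(s)\varphi(t)^{-1}:(s,t)\in S\}$ is finite. A coarse map $\varphi\colon G\to H$ is a *coarse equivalence* if there is a coarse map $\psi\colon H\to G$ such that $\{\psi(\varphi(x))x^{-1}:x\in G\}$ and $\{\varphi(\psi(y))y^{-1}:y\in H\}$ are finite. A *system* $G\curvearrowright X$ is an action of $G$ by homeomorphisms on a nonempty locally compact Hausdorff space $X$; it is *topologically free* if $\{x\in X: g.x\neq x\}$ is dense in $X$ for every $g\neq e$. Its transformation groupoid $X\rtimes G$ has space of arrows $G\times X$, where $(g,x)$ has source $x$ and range $g.x$, and product $(g,h.x)(h,x)=(gh,x)$. Systems $G\curvearrowright X$ and $H\curvearrowright Y$ are *Kakutani equivalent*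 if there are clopen sets $A\subseteq X$, $B\subseteq Y$ with $G.A=X$, $H.B=Y$ and an isomorphism of topological groupoids $(X\rtimes G)|_A\cong(Y\rtimes H)|_B$, where $|_A$ denotes restriction to the arrows with source and range in $A$. A continuous map $p\colon X\to Y$ is a *continuous orbit map* if there is a continuous map $a\colon G\times X\to H$ with $p(g.x)=a(g,x).p(x)$ for all $g\in G$, $x\in X$. A *continuous orbit couple* for $G\curvearrowright X$ and $H\curvearrowright Y$ consists of continuous orbit maps $p\colon X\to Y$ and $q\colon Y\to X$ for which there are continuous maps $g\colon X\to G$ and $h\colon Y\to H$ with $q(p(x))=g(x).x$ and $p(q(y))=h(y).y$ for all $x\in X$, $y\in Y$. The systems are *continuously orbit equivalent* if there are continuous orbit maps $p\colon X\to Y$ and $q\colon Y\to X$ with $q\circ p=\mathrm{id}_X$ and $p\circ q=\mathrm{id}_Y$. **Theorem.** 1. The following are equivalent: - there exists a coarse embedding $G\to H$; - there exist Kakutani equivalent topologically free systems $G\curvearrowright X$ and $H\curvearrowright Y$ with $X$ compact; - there is a continuous orbit couple for some topologically free systems $G\curvearrowright X$ and $H\curvearrowright Y$ with $X$ compact. 2.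 The following are equivalent: - there exists a coarse equivalence $G\to H$; - there exist Kakutani equivalent topologically free systems $G\curvearrowright X$ and $H\curvearrowright Y$ with $X$ and $Y$ compact; - there is a continuous orbit couple for some topologically free systems $G\curvearrowright X$ and $H\curvearrowright Y$ with $X$ and $Y$ compact. 3. There is a bijective coarse equivalence $G\to H$ if and only if there exist continuously orbit equivalent topologically free systems $G\curvearrowright X$ and $H\curvearrowright Y$ with $X$ and $Y$ compact. In each of the dynamical conditions in 1, 2 and 3, the spaces $X$ and $Y$ can moreover be chosen to be totally disconnected and second countable, that is, each dynamical condition is equivalent to the same condition with this additional requirement. -/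

import Mathlib

universe u₁ u₂ v w

/-! ### Coarse maps between groups -/

/-- The set `{s t⁻¹ | (s, t) ∈ S}` is finite. -/
def FiniteQuotients {G : Type*} [Group G] (S : Set (G × G)) : Prop :=
  ((fun p : G × G => p.1 * p.2⁻¹) '' S).Finite

/-- A coarse map: point preimages are finite, and finiteness of `{s t⁻¹ | (s, t) ∈ S}` implies
finiteness of `{φ s (φ t)⁻¹ | (s, t) ∈ S}`. -/
def IsCoarseMap {G H : Type*} [Group G] [Group H] (φ : G → H) : Prop :=
  (∀ y : H, (φ ⁻¹' {y}).Finite) ∧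
    ∀ S : Set (G × G), FiniteQuotients S → FiniteQuotients (Prod.map φ φ '' S)

/-- A coarse embedding: `{s t⁻¹ | (s, t) ∈ S}` is finite if and only if
`{φ s (φ t)⁻¹ | (s, t) ∈ S}` is. -/
def IsCoarseEmbedding {G H : Type*} [Group G] [Group H] (φ : G → H) : Prop :=
  ∀ S : Set (G × G), FiniteQuotients S ↔ FiniteQuotients (Prod.map φ φ '' S)

/-- Two maps into a group are close if `{φ x (ψ x)⁻¹ | x}` is finite. -/
def AreClose {G H : Type*} [Group H] (φ ψ : G → H) : Prop :=
  (Set.range fun x => φ x * (ψ x)⁻¹).Finite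

/-- A coarse equivalence: a coarse map with a coarse inverse up to closeness. -/
def IsCoarseEquivalence {G H : Type*} [Group G] [Group H] (φ : G → H) : Prop :=
  IsCoarseMap φ ∧ ∃ ψ : H → G, IsCoarseMap ψ ∧ AreClose (ψ ∘ φ) id ∧ AreClose (φ ∘ ψ) id

/-! ### Topological groupoids -/

/-- A topological groupoid with space of units `U` and space of arrows `A`. The product `γ δ` is
defined when the source of `γ` is the range of `δ`. -/
structure TopGroupoid (U A : Type*) [TopologicalSpace U] [TopologicalSpace A] where
  src : A → U
  rng : A → U
  unit : U → A
  inv : A → A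
  mul : ∀ γ δ : A, src γ = rng δ → A
  src_unit : ∀ u, src (unit u) = u
  rng_unit : ∀ u, rng (unit u) = u
  src_inv : ∀ γ, src (inv γ) = rng γ
  rng_inv : ∀ γ, rng (inv γ) = src γ
  src_mul : ∀ γ δ h, src (mul γ δ h) = src δ
  rng_mul : ∀ γ δ h, rng (mul γ δ h) = rng γ
  mul_assoc : ∀ γ δ ε (h : src γ = rng δ) (k : src δ = rng ε),
    mul (mul γ δ h) ε ((src_mul γ δ h).trans k) = mul γ (mul δ ε k) (h.trans (rng_mul δ ε k).symm)
  mul_unit : ∀ γ, mul γ (unit (src γ)) (rng_unit _).symm = γ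
  unit_mul : ∀ γ, mul (unit (rng γ)) γ (src_unit _) = γ
  mul_inv : ∀ γ, mul γ (inv γ) (rng_inv γ).symm = unit (rng γ)
  inv_mul : ∀ γ, mul (inv γ) γ (src_inv γ) = unit (src γ)
  continuous_src : Continuous src
  continuous_rng : Continuous rng
  continuous_unit : Continuous unit
  continuous_inv : Continuous inv
  continuous_mul : Continuous fun p : {p : A × A // src p.1 = rng p.2} => mul p.1.1 p.1.2 p.2

namespace TopGroupoid

variable {U A U' A' : Type*} [TopologicalSpace U] [TopologicalSpace A]
  [TopologicalSpace U'] [TopologicalSpace A']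

/-- The restriction `𝒢|E = s⁻¹(E) ∩ r⁻¹(E)` of a topological groupoid to a set `E` of units, with
the subspace topologies. -/
def restrict (𝒢 : TopGroupoid U A) (E : Set U) :
    TopGroupoid E {γ : A // 𝒢.src γ ∈ E ∧ 𝒢.rng γ ∈ E} where
  src γ := ⟨𝒢.src γ.1, γ.2.1⟩
  rng γ := ⟨𝒢.rng γ.1, γ.2.2⟩
  unit u := ⟨𝒢.unit u.1, by rw [𝒢.src_unit]; exact u.2, by rw [𝒢.rng_unit]; exact u.2⟩
  inv γ := ⟨𝒢.inv γ.1, by rw [𝒢.src_inv]; exact γ.2.2, by rw [𝒢.rng_inv]; exact γ.2.1⟩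
  mul γ δ h := ⟨𝒢.mul γ.1 δ.1 (congrArg Subtype.val h),
    by rw [𝒢.src_mul]; exact δ.2.1, by rw [𝒢.rng_mul]; exact γ.2.2⟩
  src_unit u := Subtype.ext (𝒢.src_unit u.1)
  rng_unit u := Subtype.ext (𝒢.rng_unit u.1)
  src_inv γ := Subtype.ext (𝒢.src_inv γ.1)
  rng_inv γ := Subtype.ext (𝒢.rng_inv γ.1)
  src_mul γ δ h := Subtype.ext (𝒢.src_mul γ.1 δ.1 _)
  rng_mul γ δ h := Subtype.ext (𝒢.rng_mul γ.1 δ.1 _)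
  mul_assoc γ δ ε h k := Subtype.ext
    (𝒢.mul_assoc γ.1 δ.1 ε.1 (congrArg Subtype.val h) (congrArg Subtype.val k))
  mul_unit γ := Subtype.ext (𝒢.mul_unit γ.1)
  unit_mul γ := Subtype.ext (𝒢.unit_mul γ.1)
  mul_inv γ := Subtype.ext (𝒢.mul_inv γ.1)
  inv_mul γ := Subtype.ext (𝒢.inv_mul γ.1)
  continuous_src := (𝒢.continuous_src.comp continuous_subtype_val).subtype_mk _
  continuous_rng := (𝒢.continuous_rng.comp continuous_subtype_val).subtype_mk _
  continuous_unit := (𝒢.continuous_unit.comp continuous_subtype_val).subtype_mk _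
  continuous_inv := (𝒢.continuous_inv.comp continuous_subtype_val).subtype_mk _
  continuous_mul := by
    refine Continuous.subtype_mk (𝒢.continuous_mul.comp (Continuous.subtype_mk
      (f := fun p : {p : {γ : A // 𝒢.src γ ∈ E ∧ 𝒢.rng γ ∈ E} ×
        {γ : A // 𝒢.src γ ∈ E ∧ 𝒢.rng γ ∈ E} //
          (⟨𝒢.src p.1.1, p.1.2.1⟩ : E) = ⟨𝒢.rng p.2.1, p.2.2.2⟩} => (p.1.1.1, p.1.2.1))
      (by fun_prop) (fun p => congrArg Subtype.val p.2))) _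

/-- An isomorphism of topological groupoids: homeomorphisms of the unit spaces and of the arrow
spaces that respect source, range and product (hence also units and inverses). -/
structure Iso (𝒢 : TopGroupoid U A) (ℋ : TopGroupoid U' A') where
  onUnits : U ≃ₜ U'
  onArrows : A ≃ₜ A'
  map_src : ∀ γ, ℋ.src (onArrows γ) = onUnits (𝒢.src γ)
  map_rng : ∀ γ, ℋ.rng (onArrows γ) = onUnits (𝒢.rng γ)
  map_mul : ∀ γ δ (h : 𝒢.src γ = 𝒢.rng δ), onArrows (𝒢.mul γ δ h) =
    ℋ.mul (onArrows γ) (onArrows δ) ((map_src γ).trans ((congrArg onUnits h).trans (map_rng δ).symm))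

end TopGroupoid

/-! ### Topological dynamical systems -/

/-- A topological dynamical system of a group `G`: an action of `G` by homeomorphisms on a locally
compact Hausdorff space. -/
structure TopDynSystem (G : Type*) [Group G] where
  /-- The underlying space. -/
  Space : Type*
  [top : TopologicalSpace Space]
  [hausdorff : T2Space Space]
  [locallyCompact : LocallyCompactSpace Space]
  [action : MulAction G Space]
  [continuousAction : ContinuousConstSMul G Space]

namespace TopDynSystem

attribute [instance] top hausdorff locallyCompact action continuousAction

variable {G H : Type*} [Group G] [Group H]

/-- Topological freeness: every nontrivial group element moves a dense set of points. -/
def IsTopFree (X : TopDynSystem G) : Prop :=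
  ∀ g : G, g ≠ 1 → Dense {x : X.Space | g • x ≠ x}

variable [TopologicalSpace G] [DiscreteTopology G] [TopologicalSpace H] [DiscreteTopology H]

/-- The transformation groupoid of `G ↷ X`: the arrow `(g, x)` has source `x` and range `g • x`,
and `(g, h • x) (h, x) = (g * h, x)`. Via `(g, x) ↦ (g • x, g)` it is isomorphic to the version on
`X × G` with range `x` and source `g⁻¹ • x` for the arrow `(x, g)`. -/
def transformationGroupoid (X : TopDynSystem G) : TopGroupoid X.Space (G × X.Space) where
  src γ := γ.2
  rng γ := γ.1 • γ.2
  unit x := (1, x)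
  inv γ := (γ.1⁻¹, γ.1 • γ.2)
  mul γ δ _ := (γ.1 * δ.1, δ.2)
  src_unit _ := rfl
  rng_unit x := one_smul G x
  src_inv _ := rfl
  rng_inv γ := inv_smul_smul γ.1 γ.2
  src_mul _ _ _ := rfl
  rng_mul γ δ h := by
    change (γ.1 * δ.1) • δ.2 = γ.1 • γ.2
    rw [mul_smul, h]
  mul_assoc γ δ ε _ _ := by simp [mul_assoc]
  mul_unit γ := by simp
  unit_mul γ := by simp
  mul_inv γ := by simp
  inv_mul γ := by simp
  continuous_src := continuous_snd
  continuous_rng := continuous_prod_of_discrete_left.2 fun g => continuous_const_smul g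
  continuous_unit := by fun_prop
  continuous_inv := (continuous_of_discreteTopology.comp continuous_fst).prodMk
    (continuous_prod_of_discrete_left.2 fun g => continuous_const_smul g)
  continuous_mul := by fun_prop

/-- Kakutani equivalence: there are clopen sets `A ⊆ X` and `B ⊆ Y` with `G.A = X` and `H.B = Y`
such that `(X ⋊ G)|A` and `(Y ⋊ H)|B` are isomorphic as topological groupoids. -/
def KakutaniEquivalent (X : TopDynSystem G) (Y : TopDynSystem H) : Prop :=
  ∃ (A : Set X.Space) (B : Set Y.Space), IsClopen A ∧ IsClopen B ∧
    (∀ x : X.Space, ∃ g : G, ∃ a ∈ A, g • a = x) ∧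
    (∀ y : Y.Space, ∃ h : H, ∃ b ∈ B, h • b = y) ∧
    Nonempty ((X.transformationGroupoid.restrict A).Iso (Y.transformationGroupoid.restrict B))

/-- A continuous orbit map: a continuous map `p : X → Y` such that `p (g • x) = a (g, x) • p x`
for some continuous `a : G × X → H`. -/
def IsContinuousOrbitMap (X : TopDynSystem G) (Y : TopDynSystem H) (p : X.Space → Y.Space) :
    Prop :=
  Continuous p ∧ ∃ a : G × X.Space → H, Continuous a ∧
    ∀ (g : G) (x : X.Space), p (g • x) = a (g, x) • p x

/-- The maps `p : X → Y` and `q : Y → X` form a continuous orbit couple. -/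
def IsContinuousOrbitCouple (X : TopDynSystem G) (Y : TopDynSystem H)
    (p : X.Space → Y.Space) (q : Y.Space → X.Space) : Prop :=
  IsContinuousOrbitMap X Y p ∧ IsContinuousOrbitMap Y X q ∧
    (∃ g : X.Space → G, Continuous g ∧ ∀ x, q (p x) = g x • x) ∧
    (∃ h : Y.Space → H, Continuous h ∧ ∀ y, p (q y) = h y • y)

/-- Continuous orbit equivalence: there are mutually inverse continuous orbit maps. -/
def ContinuouslyOrbitEquivalent (X : TopDynSystem G) (Y : TopDynSystem H) : Prop :=
  ∃ (p : X.Space → Y.Space) (q : Y.Space → X.Space),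
    IsContinuousOrbitMap X Y p ∧ IsContinuousOrbitMap Y X q ∧
    (∀ x, q (p x) = x) ∧ (∀ y, p (q y) = y)

/-- The underlying space is totally disconnected and second countable. -/
def IsTotDiscSecondCountable (X : TopDynSystem G) : Prop :=
  TotallyDisconnectedSpace X.Space ∧ SecondCountableTopology X.Space

end TopDynSystem

/-!
The maps of a continuous orbit couple are open, and on topologically free systems an open orbit map
determines its orbit cocycle `a : G × X → H`, so that `a` satisfies the cocycle identity and the
cocycles of `p` and `q` invert each other up to the continuous maps `g` and `h`
(`IsTopFree.cocycle`, `IsTopFree.cocycle_comp`). If `X` is compact, the restriction `s ↦ a (s, x)`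
to one orbit is then a coarse embedding `G → H`, because a continuous map from a compact space to a
discrete group has finite image. If `Y` is compact as well, the cocycle of `q` provides a coarse
inverse. A Kakutani equivalence gives a continuous orbit couple: points are moved continuously into
the clopen set `A`, and the groupoid isomorphism is applied there.

Conversely, let `φ : G → H` be a coarse embedding. Attach to it labels in `G` with finitely many
values that separate the points of its fibres, and let `Ω` be the closure of the orbit of the
labelled map in the space of maps `G → H × G`, on which `G` acts by translating the argument and
`H` by multiplying the value (`hull`). The bounds that make `φ` a coarse embedding, the injectivity
of the labelled map, and coarse surjectivity involve only finitely many arguments at a time, hence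
hold for all points of `Ω`. They show that `Ω` is locally compact and that both commuting
actions have clopen transversals: for `H` the maps with value `1` at `1`, which form a compact set,
and for `G` the maps whose least value, in an enumeration of `H × G` starting with the identity, is
taken at `1`, which form a compact set if `φ` is coarsely surjective. The quotient systems
`G ↷ Ω / H` and `H ↷ Ω / G` live on these transversals and restrict to isomorphic groupoids on their
intersection (`kakutaniEquivalent_system`), which meets every orbit. If `φ` is bijective the two
transversals agree, and the systems are continuously orbit equivalent. Multiplying `Ω` by a
topologically free Cantor system of `G × H` makes both systems topologically free.
-/

open Set Filter Topology

/-! ### Coarse maps -/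

section Coarse

theorem finiteQuotients_image_iff {G H : Type*} [Group H] (φ : G → H) (S : Set (G × G)) :
    FiniteQuotients (Prod.map φ φ '' S) ↔
      ((fun p : G × G => φ p.1 * (φ p.2)⁻¹) '' S).Finite := by
  rw [FiniteQuotients, image_image]
  rfl

variable {G H : Type*} [Group G] [Group H]

/-- Coarse embeddings are finite-to-one: the quotients of the points of a fibre all have image
`{1}`. -/
theorem IsCoarseEmbedding.isCoarseMap {φ : G → H} (hφ : IsCoarseEmbedding φ) :
    IsCoarseMap φ := by
  refine ⟨fun y => ?_, fun S hS => (hφ S).1 hS⟩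
  rcases (φ ⁻¹' {y}).eq_empty_or_nonempty with h | ⟨t, ht⟩
  · rw [h]
    exact finite_empty
  · have h : FiniteQuotients ((fun s => (s, t)) '' (φ ⁻¹' {y})) := by
      refine (hφ _).2 ((finiteQuotients_image_iff _ _).2 ((finite_singleton 1).subset ?_))
      rintro _ ⟨_, ⟨s, hs, rfl⟩, rfl⟩
      simp only [mem_preimage, mem_singleton_iff] at hs ht ⊢
      rw [hs, ht, mul_inv_cancel]
    rw [FiniteQuotients, image_image] at h
    exact Finite.of_finite_image h (mul_left_injective t⁻¹).injOn

theorem IsCoarseEquivalence.isCoarseEmbedding {φ : G → H} (hφ : IsCoarseEquivalence φ) :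
    IsCoarseEmbedding φ := by
  obtain ⟨h, ψ, hψ, hE, -⟩ := hφ
  refine fun S => ⟨h.2 S, fun hS => ?_⟩
  have hM := hψ.2 _ hS
  rw [finiteQuotients_image_iff, image_image] at hM
  refine ((hE.inv.mul hM).mul hE).subset ?_
  rintro _ ⟨⟨s, t⟩, hst, rfl⟩
  refine ⟨_, ⟨_, inv_mem_inv.2 ⟨s, rfl⟩, _, ⟨_, hst, rfl⟩, rfl⟩, _, ⟨t, rfl⟩, ?_⟩
  simp [mul_assoc]

theorem IsCoarseEmbedding.finite_quotients {φ : G → H} (hφ : IsCoarseEmbedding φ) (r : G) :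
    (range fun v => φ (r * v) * (φ v)⁻¹).Finite := by
  have h := (hφ (range fun v => (r * v, v))).1 ((finite_singleton r).subset (by
    rintro _ ⟨_, ⟨v, rfl⟩, rfl⟩
    simp))
  rwa [finiteQuotients_image_iff, ← range_comp] at h

theorem IsCoarseEmbedding.finite_translations {φ : G → H} (hφ : IsCoarseEmbedding φ) (c : H) :
    {r : G | ∃ v, φ (r * v) * (φ v)⁻¹ = c}.Finite := by
  have h := (hφ {p | φ p.1 * (φ p.2)⁻¹ = c}).2
    ((finiteQuotients_image_iff _ _).2 ((finite_singleton c).subset (by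
      rintro _ ⟨p, hp, rfl⟩
      exact hp)))
  refine h.subset ?_
  rintro r ⟨v, hv⟩
  exact ⟨(r * v, v), hv, by simp⟩

end Coarse

/-! ### Continuous orbit couples yield coarse maps -/

theorem IsCompact.finite_image_of_discrete {T D : Type*} [TopologicalSpace T]
    [TopologicalSpace D] [DiscreteTopology D] {K : Set T} (hK : IsCompact K) {f : T → D}
    (hf : Continuous f) : (f '' K).Finite :=
  (hK.image hf).finite_of_discrete

namespace TopDynSystem

variable {G H : Type*} [Group G] [Group H]
  [TopologicalSpace G] [DiscreteTopology G] [TopologicalSpace H] [DiscreteTopology H]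

/-- Topological freeness makes the group elements in an orbit relation unique as soon as they
depend continuously on the point, even at points with nontrivial stabilizer. -/
theorem IsTopFree.eq_of_smul_eq {Y : TopDynSystem H} (hY : Y.IsTopFree) {T : Type*}
    [TopologicalSpace T] {p : T → Y.Space} (hp : IsOpenMap p) {k l : T → H} (hk : Continuous k)
    (hl : Continuous l) (h : ∀ t, k t • p t = l t • p t) (t : T) : k t = l t := by
  by_contra hne
  have hopen : IsOpen (k ⁻¹' {k t} ∩ l ⁻¹' {l t}) :=
    ((isOpen_discrete _).preimage hk).inter ((isOpen_discrete _).preimage hl)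
  obtain ⟨_, ht', t', ⟨hk', hl'⟩, rfl⟩ := (hY ((l t)⁻¹ * k t)
    fun h1 => hne (inv_mul_eq_one.1 h1).symm).exists_mem_open (hp _ hopen)
      ⟨p t, t, ⟨rfl, rfl⟩, rfl⟩
  apply ht'
  have := h t'
  rw [show k t' = k t from hk', show l t' = l t from hl'] at this
  rw [mul_smul, this, inv_smul_smul]

/-- The maps of a continuous orbit couple are open: near `p x` the map `y ↦ (g x)⁻¹ • q y` is a
local section of `p`. -/
theorem isOpenMap_of_couple {X : TopDynSystem G} {Y : TopDynSystem H}
    {p : X.Space → Y.Space} {q : Y.Space → X.Space} (hp : Continuous p) (hq : Continuous q)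
    {g : X.Space → G} (hg : Continuous g) (hgq : ∀ x, q (p x) = g x • x)
    {h : Y.Space → H} (hh : Continuous h) (hhp : ∀ y, p (q y) = h y • y) : IsOpenMap p := by
  refine IsOpenMap.of_nhds_le fun x S hS => ?_
  have hx : (g x)⁻¹ • q (p x) = x := by rw [hgq, inv_smul_smul]
  have hu : Tendsto (fun y => (g x)⁻¹ • q y) (𝓝 (p x)) (𝓝 x) := by
    have : Continuous fun y => (g x)⁻¹ • q y := hq.const_smul _
    simpa only [hx] using this.tendsto (p x)
  have h1 : ∀ᶠ y in 𝓝 (p x), h y = h (p x) :=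
    hh.continuousAt.eventually (isOpen_discrete {h (p x)} |>.mem_nhds rfl)
  have h2 : ∀ᶠ u in 𝓝 x, g u = g x :=
    hg.continuousAt.eventually (isOpen_discrete {g x} |>.mem_nhds rfl)
  have h3 : ∀ᶠ u in 𝓝 x, h (p u) = h (p x) := hp.continuousAt.eventually h1
  filter_upwards [h1, hu.eventually h2, hu.eventually h3, hu.eventually hS] with y hy h2 h3 hS
  have h4 := hhp (p ((g x)⁻¹ • q y))
  rw [hgq, h2, smul_inv_smul, hhp, h3, hy] at h4
  rw [smul_left_cancel _ h4]
  exact hS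

section Couple

variable {X : TopDynSystem G} {Y : TopDynSystem H}
  {p : X.Space → Y.Space} {q : Y.Space → X.Space}
  {a : G × X.Space → H} {b : H × Y.Space → G} {g : X.Space → G} {h : Y.Space → H}

omit [DiscreteTopology G] in
theorem IsTopFree.cocycle (hY : Y.IsTopFree) (hp : IsOpenMap p)
    (ha : Continuous a) (hap : ∀ s x, p (s • x) = a (s, x) • p x) (s t : G) (x : X.Space) :
    a (s * t, x) = a (s, t • x) * a (t, x) := by
  refine hY.eq_of_smul_eq hp (k := fun x => a (s * t, x))
    (l := fun x => a (s, t • x) * a (t, x)) (by fun_prop)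
    ((ha.comp (by fun_prop : Continuous fun x : X.Space => (s, t • x))).mul
      (ha.comp (by fun_prop : Continuous fun x : X.Space => (t, x)))) (fun x => ?_) x
  rw [← hap, mul_smul, hap, hap, mul_smul]

omit [DiscreteTopology H] in
theorem IsTopFree.cocycle_comp (hX : X.IsTopFree) (hp : Continuous p)
    (ha : Continuous a) (hap : ∀ s x, p (s • x) = a (s, x) • p x)
    (hb : Continuous b) (hbq : ∀ s y, q (s • y) = b (s, y) • q y)
    (hg : Continuous g) (hgq : ∀ x, q (p x) = g x • x) (s : G) (x : X.Space) :
    b (a (s, x), p x) * g x = g (s • x) * s := by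
  refine hX.eq_of_smul_eq (p := id) IsOpenMap.id (k := fun x => b (a (s, x), p x) * g x)
    (l := fun x => g (s • x) * s) (by fun_prop)
    ((hg.comp (continuous_const_smul s)).mul continuous_const) (fun x => ?_) x
  simp only [id]
  rw [mul_smul, mul_smul, ← hgq, ← hgq, ← hbq, hap]

omit [DiscreteTopology G] in
theorem IsTopFree.cocycle_translation (hY : Y.IsTopFree) (hp : IsOpenMap p) (hpc : Continuous p)
    (ha : Continuous a) (hap : ∀ s x, p (s • x) = a (s, x) • p x)
    (hg : Continuous g) (hgq : ∀ x, q (p x) = g x • x)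
    (hh : Continuous h) (hhp : ∀ y, p (q y) = h y • y) (x : X.Space) :
    a (g x, x) = h (p x) := by
  refine hY.eq_of_smul_eq hp (k := fun x => a (g x, x)) (l := fun x => h (p x))
    (by fun_prop) (by fun_prop) (fun x => ?_) x
  rw [← hap, ← hgq, hhp]

/-- An orbit cocycle of a continuous orbit couple with compact first space, restricted to one
orbit, is a coarse embedding. -/
theorem isCoarseEmbedding_cocycle [CompactSpace X.Space] (hX : X.IsTopFree)
    (hpc : Continuous p)
    (ha : Continuous a) (hap : ∀ s x, p (s • x) = a (s, x) • p x)
    (hb : Continuous b) (hbq : ∀ s y, q (s • y) = b (s, y) • q y)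
    (hg : Continuous g) (hgq : ∀ x, q (p x) = g x • x)
    (hco : ∀ s t x, a (s * t, x) = a (s, t • x) * a (t, x)) (x : X.Space) :
    IsCoarseEmbedding fun s => a (s, x) := by
  have key : ∀ s t : G, a (s, x) * (a (t, x))⁻¹ = a (s * t⁻¹, t • x) := fun s t => by
    rw [mul_inv_eq_iff_eq_mul, ← hco, inv_mul_cancel_right]
  refine fun S => ⟨fun hS => ?_, fun hS => ?_⟩
  · rw [finiteQuotients_image_iff]
    refine ((hS.isCompact.prod (isCompact_univ (X := X.Space))).finite_image_of_discrete
      ha).subset ?_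
    rintro _ ⟨⟨s, t⟩, hst, rfl⟩
    exact ⟨(s * t⁻¹, t • x), ⟨⟨_, hst, rfl⟩, mem_univ _⟩, (key s t).symm⟩
  · rw [finiteQuotients_image_iff] at hS
    have hF := (isCompact_univ (X := X.Space)).finite_image_of_discrete hg
    have hB := (hS.isCompact.prod
      ((isCompact_univ (X := X.Space)).image hpc)).finite_image_of_discrete hb
    refine ((hF.inv.mul hB).mul hF).subset ?_
    rintro _ ⟨⟨s, t⟩, hst, rfl⟩
    refine ⟨_, ⟨_, inv_mem_inv.2 ⟨(s * t⁻¹) • t • x, mem_univ _, rfl⟩, _,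
      ⟨(a (s * t⁻¹, t • x), p (t • x)), ⟨⟨_, hst, key s t⟩, _, mem_univ _, rfl⟩, rfl⟩, rfl⟩, _,
      ⟨t • x, mem_univ _, rfl⟩, ?_⟩
    simp only
    rw [mul_assoc, hX.cocycle_comp hpc ha hap hb hbq hg hgq, inv_mul_cancel_left]

end Couple

theorem IsContinuousOrbitCouple.exists_isCoarseEmbedding {X : TopDynSystem G} {Y : TopDynSystem H}
    {p : X.Space → Y.Space} {q : Y.Space → X.Space} (hpq : X.IsContinuousOrbitCouple Y p q)
    (hX : X.IsTopFree) (hY : Y.IsTopFree) [CompactSpace X.Space] [Nonempty X.Space] :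
    ∃ φ : G → H, IsCoarseEmbedding φ := by
  obtain ⟨⟨hpc, a, ha, hap⟩, ⟨hqc, b, hb, hbq⟩, ⟨g, hg, hgq⟩, h, hh, hhp⟩ := hpq
  have hp := isOpenMap_of_couple hpc hqc hg hgq hh hhp
  exact ⟨_, isCoarseEmbedding_cocycle hX hpc ha hap hb hbq hg hgq (hY.cocycle hp ha hap)
    (Classical.arbitrary X.Space)⟩

omit [DiscreteTopology G] [DiscreteTopology H] in
theorem IsContinuousOrbitCouple.of_inverse {X : TopDynSystem G} {Y : TopDynSystem H}
    {p : X.Space → Y.Space} {q : Y.Space → X.Space}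
    (hp : X.IsContinuousOrbitMap Y p) (hq : Y.IsContinuousOrbitMap X q)
    (hqp : ∀ x, q (p x) = x) (hpq : ∀ y, p (q y) = y) : X.IsContinuousOrbitCouple Y p q :=
  ⟨hp, hq, ⟨fun _ => 1, continuous_const, by simpa using hqp⟩,
    ⟨fun _ => 1, continuous_const, by simpa using hpq⟩⟩

/-- The coarse inverse of `s ↦ a (s, x)` is `t ↦ b (t, p x) * g x`; the right translation by `g x`
is what makes the two maps mutually inverse up to bounded *left* translations, and exactly
inverse when `p` and `q` are. -/
theorem IsContinuousOrbitCouple.exists_isCoarseEquivalence {X : TopDynSystem G}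
    {Y : TopDynSystem H} {p : X.Space → Y.Space} {q : Y.Space → X.Space}
    (hpq : X.IsContinuousOrbitCouple Y p q) (hX : X.IsTopFree) (hY : Y.IsTopFree)
    [CompactSpace X.Space] [CompactSpace Y.Space] [Nonempty X.Space] :
    ∃ φ : G → H, IsCoarseEquivalence φ ∧
      ((∀ x, q (p x) = x) → (∀ y, p (q y) = y) → Function.Bijective φ) := by
  obtain ⟨⟨hpc, a, ha, hap⟩, ⟨hqc, b, hb, hbq⟩, ⟨g, hg, hgq⟩, h, hh, hhp⟩ := hpq
  have hp := isOpenMap_of_couple hpc hqc hg hgq hh hhp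
  have hq := isOpenMap_of_couple hqc hpc hh hhp hg hgq
  have x : X.Space := Classical.arbitrary X.Space
  have hca := hY.cocycle hp ha hap
  have hcb := hX.cocycle hq hb hbq
  have h1 : ∀ s, b (a (s, x), p x) * g x = g (s • x) * s := fun s =>
    hX.cocycle_comp hpc ha hap hb hbq hg hgq s x
  have h2 : ∀ t, a (b (t, p x) * g x, x) = h (t • p x) * t := fun t => by
    rw [hca, ← hgq, hY.cocycle_translation hp hpc ha hap hg hgq hh hhp,
      hY.cocycle_comp hqc hb hbq ha hap hh hhp]
  have hb' := (isCoarseEmbedding_cocycle hY hqc hb hbq ha hap hh hhp hcb (p x)).isCoarseMap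
  refine ⟨fun s => a (s, x), ⟨(isCoarseEmbedding_cocycle hX hpc ha hap hb hbq hg hgq hca
    x).isCoarseMap, fun t => b (t, p x) * g x, ⟨fun s => ?_, fun S hS => ?_⟩, ?_, ?_⟩,
    fun hqp hpq => ⟨fun s s' hs => ?_, fun t => ⟨b (t, p x) * g x, ?_⟩⟩⟩
  · convert hb'.1 (s * (g x)⁻¹) using 1
    ext t
    simp [eq_mul_inv_iff_mul_eq]
  · have := hb'.2 S hS
    rw [finiteQuotients_image_iff] at this ⊢
    simpa [mul_assoc] using this
  · refine (isCompact_univ.finite_image_of_discrete hg).subset ?_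
    rintro _ ⟨s, rfl⟩
    exact ⟨s • x, mem_univ _, by simp [h1]⟩
  · refine (isCompact_univ.finite_image_of_discrete hh).subset ?_
    rintro _ ⟨t, rfl⟩
    exact ⟨t • p x, mem_univ _, by simp [h2]⟩
  · have h3 : ∀ x, g x = 1 := hX.eq_of_smul_eq (p := id) IsOpenMap.id hg
      (l := fun _ => 1) continuous_const fun x => by rw [one_smul, id, ← hgq, hqp]
    have h4 := h1 s
    have h5 := h1 s'
    simp only [h3, mul_one, one_mul] at h4 h5 hs
    rw [← h4, ← h5, hs]
  · have h3 : ∀ y, h y = 1 := hY.eq_of_smul_eq (p := id) IsOpenMap.id hh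
      (l := fun _ => 1) continuous_const fun y => by rw [one_smul, id, ← hhp, hpq]
    simp only [h2, h3, one_mul]

end TopDynSystem

/-! ### Kakutani equivalences yield continuous orbit couples -/

namespace TopDynSystem

variable {G H : Type*} [Group G] [Group H]
  [TopologicalSpace G] [DiscreteTopology G] [TopologicalSpace H] [DiscreteTopology H]

/-- A clopen set meeting every orbit can be reached by a continuous choice of group elements. -/
theorem exists_continuous_smul_mem [Countable G] (X : TopDynSystem G) {A : Set X.Space}
    (hA : IsClopen A) (hfull : ∀ x : X.Space, ∃ g : G, ∃ a ∈ A, g • a = x) :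
    ∃ s : X.Space → G, Continuous s ∧ ∀ x, s x • x ∈ A := by
  obtain ⟨ν, hν⟩ := exists_injective_nat G
  have hne : ∀ x : X.Space, {g : G | g • x ∈ A}.Nonempty := fun x => by
    obtain ⟨g, a, ha, rfl⟩ := hfull x
    exact ⟨g⁻¹, by simpa using ha⟩
  have hmem : ∀ g : G, IsClopen {x : X.Space | g • x ∈ A} := fun g =>
    hA.preimage (continuous_const_smul g)
  refine ⟨fun x => Function.argminOn ν _ (hne x), continuous_discrete_rng.2 fun g => ?_,
    fun x => Function.argminOn_mem ν _ (hne x)⟩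
  -- The choice equals `g` exactly when `g` works and none of the finitely many predecessors does.
  have hfin : {k : G | ν k < ν g}.Finite := (finite_lt_nat (ν g)).preimage hν.injOn
  have : (fun x => Function.argminOn ν _ (hne x)) ⁻¹' {g} =
      {x : X.Space | g • x ∈ A} ∩ ⋂ k ∈ {k : G | ν k < ν g}, {x : X.Space | k • x ∈ A}ᶜ := by
    ext x
    simp only [mem_preimage, mem_singleton_iff, mem_inter_iff, mem_iInter, mem_compl_iff,
      mem_ofPred_eq]
    refine ⟨?_, fun ⟨h1, h2⟩ => hν (le_antisymm (Function.argminOn_le ν _ h1) ?_)⟩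
    · rintro rfl
      exact ⟨Function.argminOn_mem ν _ (hne x), fun k hk hkx =>
        hk.not_ge (Function.argminOn_le ν _ hkx)⟩
    · exact not_lt.1 fun hlt => h2 _ hlt (Function.argminOn_mem ν _ (hne x))
  rw [this]
  exact (hmem g).isOpen.inter (hfin.isOpen_biInter fun k _ => (hmem k).compl.isOpen)

omit [DiscreteTopology H] in
/-- An orbit map defined on a set `A` extends to the whole space along a continuous choice of
group elements moving points into `A`. -/
theorem isContinuousOrbitMap_of_restrict {X : TopDynSystem G} {Y : TopDynSystem H}
    {A : Set X.Space} {θ : A → Y.Space} (hθ : Continuous θ)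
    {α : {γ : G × X.Space // γ.2 ∈ A ∧ γ.1 • γ.2 ∈ A} → H} (hα : Continuous α)
    (h : ∀ γ, θ ⟨γ.1.1 • γ.1.2, γ.2.2⟩ = α γ • θ ⟨γ.1.2, γ.2.1⟩)
    {s : X.Space → G} (hs : Continuous s) (hsA : ∀ x, s x • x ∈ A) :
    X.IsContinuousOrbitMap Y fun x => θ ⟨s x • x, hsA x⟩ := by
  have hsmul : Continuous fun p : G × X.Space => p.1 • p.2 :=
    continuous_prod_of_discrete_left.2 fun g => continuous_const_smul g
  have hs' : Continuous fun x => s x • x := hsmul.comp (hs.prodMk continuous_id)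
  have key : ∀ (g : G) (x : X.Space),
      (s (g • x) * g * (s x)⁻¹) • s x • x = s (g • x) • g • x := fun g x => by
    simp [mul_smul]
  refine ⟨hθ.comp (hs'.subtype_mk _), fun p => α ⟨(s (p.1 • p.2) * p.1 * (s p.2)⁻¹, s p.2 • p.2),
    hsA _, by simp only [key]; exact hsA _⟩, hα.comp (Continuous.subtype_mk ?_ _), fun g x => ?_⟩
  · exact (((hs.comp hsmul).mul continuous_fst).mul (hs.comp continuous_snd).inv).prodMk
      (hs'.comp continuous_snd)
  · rw [← h]
    simp only [key]

theorem KakutaniEquivalent.exists_isContinuousOrbitCouple [Countable G] [Countable H]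
    {X : TopDynSystem G} {Y : TopDynSystem H} (hXY : X.KakutaniEquivalent Y) :
    ∃ p q, X.IsContinuousOrbitCouple Y p q := by
  obtain ⟨A, B, hA, hB, hAX, hBY, ⟨Φ⟩⟩ := hXY
  obtain ⟨s, hs, hsA⟩ := X.exists_continuous_smul_mem hA hAX
  obtain ⟨t, ht, htB⟩ := Y.exists_continuous_smul_mem hB hBY
  have hsX : Continuous fun x => s x • x :=
    (continuous_prod_of_discrete_left.2 fun g => continuous_const_smul g :
      Continuous fun p : G × X.Space => p.1 • p.2).comp (hs.prodMk continuous_id)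
  have htY : Continuous fun y => t y • y :=
    (continuous_prod_of_discrete_left.2 fun g => continuous_const_smul g :
      Continuous fun p : H × Y.Space => p.1 • p.2).comp (ht.prodMk continuous_id)
  let θ : A → Y.Space := fun x => (Φ.onUnits x).1
  let η : B → X.Space := fun y => (Φ.onUnits.symm y).1
  let α : {γ : G × X.Space // γ.2 ∈ A ∧ γ.1 • γ.2 ∈ A} → H := fun γ => (Φ.onArrows γ).1.1
  let β : {γ : H × Y.Space // γ.2 ∈ B ∧ γ.1 • γ.2 ∈ B} → G := fun γ => (Φ.onArrows.symm γ).1.1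
  have hθ : Continuous θ := continuous_subtype_val.comp Φ.onUnits.continuous
  have hη : Continuous η := continuous_subtype_val.comp Φ.onUnits.symm.continuous
  have hα : Continuous α :=
    continuous_fst.comp (continuous_subtype_val.comp Φ.onArrows.continuous)
  have hβ : Continuous β :=
    continuous_fst.comp (continuous_subtype_val.comp Φ.onArrows.symm.continuous)
  have hθα : ∀ γ, θ ⟨γ.1.1 • γ.1.2, γ.2.2⟩ = α γ • θ ⟨γ.1.2, γ.2.1⟩ := fun γ => by
    have h1 := congrArg Subtype.val (Φ.map_src γ)
    have h2 := congrArg Subtype.val (Φ.map_rng γ)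
    exact (h2.symm : _ = (Φ.onArrows γ).1.1 • (Φ.onArrows γ).1.2).trans
      (congrArg (fun y => (Φ.onArrows γ).1.1 • y) h1)
  have hηβ : ∀ γ, η ⟨γ.1.1 • γ.1.2, γ.2.2⟩ = β γ • η ⟨γ.1.2, γ.2.1⟩ := fun γ => by
    obtain ⟨δ, rfl⟩ := Φ.onArrows.surjective γ
    have h1 := congrArg (fun y => (Φ.onUnits.symm y).1) (Φ.map_src δ)
    have h2 := congrArg (fun y => (Φ.onUnits.symm y).1) (Φ.map_rng δ)
    simp only [Homeomorph.symm_apply_apply] at h1 h2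
    refine h2.trans ?_
    change δ.1.1 • δ.1.2 = (Φ.onArrows.symm (Φ.onArrows δ)).1.1 • _
    rw [Φ.onArrows.symm_apply_apply]
    exact congrArg (fun y => δ.1.1 • y) h1.symm
  have hθB : ∀ x, θ x ∈ B := fun x => (Φ.onUnits x).2
  have hηA : ∀ y, η y ∈ A := fun y => (Φ.onUnits.symm y).2
  have hηθ : ∀ x, η ⟨θ x, hθB x⟩ = x := fun x =>
    congrArg Subtype.val (Φ.onUnits.symm_apply_apply x)
  have hθη : ∀ y, θ ⟨η y, hηA y⟩ = y := fun y =>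
    congrArg Subtype.val (Φ.onUnits.apply_symm_apply y)
  refine ⟨fun x => θ ⟨s x • x, hsA x⟩, fun y => η ⟨t y • y, htB y⟩,
    isContinuousOrbitMap_of_restrict hθ hα hθα hs hsA,
    isContinuousOrbitMap_of_restrict hη hβ hηβ ht htB,
    ⟨fun x => β ⟨(t (θ ⟨s x • x, hsA x⟩), θ ⟨s x • x, hsA x⟩), hθB _, htB _⟩ * s x, ?_,
      fun x => ?_⟩,
    ⟨fun y => α ⟨(s (η ⟨t y • y, htB y⟩), η ⟨t y • y, htB y⟩), hηA _, hsA _⟩ * t y, ?_,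
      fun y => ?_⟩⟩
  · have h1 : Continuous fun x => θ ⟨s x • x, hsA x⟩ := hθ.comp (hsX.subtype_mk _)
    exact (hβ.comp (Continuous.subtype_mk ((ht.comp h1).prodMk h1) _)).mul hs
  · refine (hηβ ⟨(t (θ ⟨s x • x, hsA x⟩), θ ⟨s x • x, hsA x⟩), hθB _, htB _⟩).trans ?_
    simp only [hηθ, mul_smul]
  · have h1 : Continuous fun y => η ⟨t y • y, htB y⟩ := hη.comp (htY.subtype_mk _)
    exact (hα.comp (Continuous.subtype_mk ((hs.comp h1).prodMk h1) _)).mul ht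
  · refine (hθα ⟨(s (η ⟨t y • y, htB y⟩), η ⟨t y • y, htB y⟩), hηA _, hsA _⟩).trans ?_
    simp only [hθη, mul_smul]

end TopDynSystem

/-! ### Topological couplings -/

/-- A transversal for an action of a discrete group `H` on a space `Ω`: a continuous map
`c : Ω → H` with `c (h • ω) = c ω * h⁻¹`. Equivalently, `{ω | c ω = 1}` is a clopen subset of `Ω`
whose translates by the elements of `H` are pairwise disjoint and cover `Ω`; the element `c ω`
moves `ω` into it. -/
structure Transversal (H Ω : Type*) [Group H] [TopologicalSpace H] [MulAction H Ω]
    [TopologicalSpace Ω] where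
  /-- The element moving a point into the transversal. -/
  toFun : Ω → H
  continuous_toFun : Continuous toFun
  map_smul : ∀ h ω, toFun (h • ω) = toFun ω * h⁻¹

namespace Transversal

variable {G H Ω : Type*} [Group G] [Group H] [TopologicalSpace G] [DiscreteTopology G]
  [TopologicalSpace H] [DiscreteTopology H] [TopologicalSpace Ω] [MulAction G Ω] [MulAction H Ω]

/-- The clopen set described by a transversal. -/
def carrier (c : Transversal H Ω) : Set Ω :=
  {ω | c.toFun ω = 1}

theorem isClopen_carrier (c : Transversal H Ω) : IsClopen c.carrier :=
  (isClopen_discrete {1}).preimage c.continuous_toFun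

omit [DiscreteTopology H] in
theorem smul_mem_carrier (c : Transversal H Ω) (ω : Ω) : c.toFun ω • ω ∈ c.carrier := by
  rw [carrier, mem_ofPred_eq, c.map_smul, mul_inv_cancel]

omit [DiscreteTopology H] in
theorem toFun_smul_eq (c : Transversal H Ω) {ω : Ω} {h : H} (hω : h • ω ∈ c.carrier) :
    c.toFun ω = h := by
  rw [carrier, mem_ofPred_eq, c.map_smul] at hω
  exact mul_inv_eq_one.1 hω

omit [DiscreteTopology G] [DiscreteTopology H] in
theorem toFun_smul_toFun_smul [SMulCommClass G H Ω] (c : Transversal H Ω) (d : Transversal G Ω)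
    {g : G} {ω : Ω} (h : c.toFun (g • ω) • g • ω ∈ d.carrier) :
    d.toFun (c.toFun (g • ω) • ω) = g := by
  rw [← smul_comm g] at h
  exact d.toFun_smul_eq h

variable [ContinuousConstSMul G Ω] [ContinuousConstSMul H Ω] [SMulCommClass G H Ω]

theorem continuous_smul_self (c : Transversal H Ω) : Continuous fun ω => c.toFun ω • ω :=
  (continuous_prod_of_discrete_left.2 fun h => continuous_const_smul h :
    Continuous fun p : H × Ω => p.1 • p.2).comp (c.continuous_toFun.prodMk continuous_id)

variable [T2Space Ω] [LocallyCompactSpace Ω]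

/-- The action of `G` on the transversal of a commuting action of `H`, which is the action of `G`
on the quotient of `Ω` by `H`: `g` sends `ω` to the point of the transversal in the `H`-orbit of
`g • ω`. The underlying space is the transversal itself, moved to a prescribed universe. -/
noncomputable def system (G : Type u₁) {H : Type u₂} {Ω : Type*} [Group G] [Group H]
    [TopologicalSpace H] [DiscreteTopology H] [TopologicalSpace Ω] [MulAction G Ω]
    [MulAction H Ω] [ContinuousConstSMul G Ω] [ContinuousConstSMul H Ω] [SMulCommClass G H Ω]
    [T2Space Ω] [LocallyCompactSpace Ω] [Small.{v} Ω]
    (c : Transversal H Ω) : TopDynSystem.{u₁, v} G :=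
  let e := Shrink.homeomorph.{v} c.carrier
  haveI := c.isClopen_carrier.isClosed.locallyCompactSpace
  letI act : MulAction G (Shrink.{v} c.carrier) :=
    { smul := fun g x => e ⟨c.toFun (g • (e.symm x).1) • g • (e.symm x).1, c.smul_mem_carrier _⟩
      one_smul := fun x => by
        change e ⟨c.toFun ((1 : G) • (e.symm x).1) • (1 : G) • (e.symm x).1, _⟩ = x
        rw [← e.eq_symm_apply]
        have hx : c.toFun (e.symm x).1 = 1 := (e.symm x).2
        ext
        simp only [one_smul, hx]
      mul_smul := fun g g' x => by
        refine congrArg e (Subtype.ext ?_)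
        change c.toFun ((g * g') • (e.symm x).1) • (g * g') • (e.symm x).1 =
          c.toFun (g • (e.symm (e _)).1) • g • (e.symm (e _)).1
        simp only [e.symm_apply_apply]
        rw [smul_comm g (c.toFun _), c.map_smul, smul_smul _ (c.toFun _), inv_mul_cancel_right,
          smul_smul] }
  { Space := Shrink.{v} c.carrier
    hausdorff := e.symm.isEmbedding.t2Space
    locallyCompact := e.symm.isClosedEmbedding.locallyCompactSpace
    action := act
    continuousAction := ⟨fun g => e.continuous.comp (Continuous.subtype_mk
      (c.continuous_smul_self.comp ((continuous_subtype_val.comp e.symm.continuous).const_smul g))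
      _)⟩ }

variable [Small.{v} Ω]

/-- The system on a transversal has the transversal as its underlying space. -/
noncomputable def homeo (G : Type u₁) {H : Type u₂} {Ω : Type*} [Group G] [Group H]
    [TopologicalSpace H] [DiscreteTopology H] [TopologicalSpace Ω] [MulAction G Ω]
    [MulAction H Ω] [ContinuousConstSMul G Ω] [ContinuousConstSMul H Ω] [SMulCommClass G H Ω]
    [T2Space Ω] [LocallyCompactSpace Ω] [Small.{v} Ω] (c : Transversal H Ω) :
    (c.system.{u₁, u₂, v} G).Space ≃ₜ c.carrier :=
  (Shrink.homeomorph.{v} c.carrier).symm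

omit [TopologicalSpace G] [DiscreteTopology G] in
theorem coe_homeo_smul (c : Transversal H Ω) (g : G) (x : (c.system.{_, _, v} G).Space) :
    (c.homeo G (g • x)).1 = c.toFun (g • (c.homeo G x).1) • g • (c.homeo G x).1 :=
  congrArg Subtype.val ((Shrink.homeomorph.{v} c.carrier).symm_apply_apply _)

omit [TopologicalSpace G] [DiscreteTopology G] in
theorem isTotDiscSecondCountable_system [TotallyDisconnectedSpace Ω] [SecondCountableTopology Ω]
    (c : Transversal H Ω) : (c.system.{_, _, v} G).IsTotDiscSecondCountable :=
  ⟨(c.homeo G).symm.totallyDisconnectedSpace, (c.homeo G).secondCountableTopology⟩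

omit [TopologicalSpace G] [DiscreteTopology G] in
theorem compactSpace_system (c : Transversal H Ω) (hc : IsCompact c.carrier) :
    CompactSpace (c.system.{_, _, v} G).Space :=
  haveI := isCompact_iff_compactSpace.1 hc
  (c.homeo G).symm.compactSpace

omit [TopologicalSpace G] [DiscreteTopology G] in
/-- If `G × H` acts topologically freely on `Ω`, then `G` acts topologically freely on the
transversals of `H`: a point fixed by `g` in the transversal is fixed by some `(g, h)` in `Ω`, with
`h` locally constant. -/
theorem isTopFree_system
    (hfree : ∀ (g : G) (h : H), g ≠ 1 → Dense {ω : Ω | h • g • ω ≠ ω}) (c : Transversal H Ω) :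
    (c.system.{_, _, v} G).IsTopFree := by
  refine fun g hg => dense_iff_inter_open.2 fun U hU ⟨x, hx⟩ => ?_
  have hi : IsOpenEmbedding fun x => (c.homeo G x).1 :=
    c.isClopen_carrier.isOpen.isOpenEmbedding_subtypeVal.comp (c.homeo G).isOpenEmbedding
  let h := c.toFun (g • (c.homeo G x).1)
  have hopen : IsOpen (U ∩ {x | c.toFun (g • (c.homeo G x).1) = h}) :=
    hU.inter ((isOpen_discrete {h}).preimage
      (c.continuous_toFun.comp (hi.continuous.const_smul g)))
  obtain ⟨_, hω, y, ⟨hyU, hy⟩, rfl⟩ := (hfree g h hg).exists_mem_open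
    (hi.isOpenMap _ hopen) ⟨_, x, ⟨hx, rfl⟩, rfl⟩
  refine ⟨y, hyU, fun hgy => hω ?_⟩
  have := c.coe_homeo_smul g y
  rw [hgy, show c.toFun (g • (c.homeo G y).1) = h from hy] at this
  exact this.symm

end Transversal

section Coupling

variable {G : Type u₁} {H : Type u₂} {Ω : Type*} [Group G] [Group H]
  [TopologicalSpace G] [DiscreteTopology G]
  [TopologicalSpace H] [DiscreteTopology H] [TopologicalSpace Ω] [MulAction G Ω] [MulAction H Ω]
  [ContinuousConstSMul G Ω] [ContinuousConstSMul H Ω] [SMulCommClass G H Ω] [SMulCommClass H G Ω]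
  [T2Space Ω] [LocallyCompactSpace Ω] [Small.{v} Ω] [Small.{w} Ω]

/-- Points of the two systems that are the same point of `Ω` stay so when `g` acts on the first
and `c (g • ω)` on the second. -/
theorem coe_homeo_smul_toFun (c : Transversal H Ω) (d : Transversal G Ω)
    {x : (c.system.{u₁, u₂, v} G).Space} {y : (d.system.{u₂, u₁, w} H).Space}
    (hxy : (d.homeo.{u₂, u₁, w} H y).1 = (c.homeo.{u₁, u₂, v} G x).1) {g : G}
    (hg : (c.homeo.{u₁, u₂, v} G (g • x)).1 ∈ d.carrier) :
    (d.homeo.{u₂, u₁, w} H (c.toFun (g • (c.homeo.{u₁, u₂, v} G x).1) • y)).1 =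
      (c.homeo.{u₁, u₂, v} G (g • x)).1 := by
  rw [c.coe_homeo_smul g x] at hg ⊢
  rw [d.coe_homeo_smul _ y, hxy, c.toFun_smul_toFun_smul d hg, smul_comm]

/-- Transversals for two commuting actions give Kakutani equivalent systems if every orbit of the
joint action meets the intersection of the transversals. Both reductions to this intersection are
the same reduction of the transformation groupoid of `G × H` on `Ω`. -/
theorem kakutaniEquivalent_system (c : Transversal H Ω) (d : Transversal G Ω)
    (hfull : ∀ ω : Ω, ∃ (g : G) (h : H), g • h • ω ∈ c.carrier ∩ d.carrier) :
    (c.system.{u₁, u₂, v} G).KakutaniEquivalent (d.system.{u₂, u₁, w} H) := by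
  let i := c.homeo.{u₁, u₂, v} G
  let j := d.homeo.{u₂, u₁, w} H
  let A : Set (c.system.{u₁, u₂, v} G).Space := {x | (i x).1 ∈ d.carrier}
  let B : Set (d.system.{u₂, u₁, w} H).Space := {y | (j y).1 ∈ c.carrier}
  have hi : Continuous fun x => (i x).1 := continuous_subtype_val.comp i.continuous
  have hj : Continuous fun y => (j y).1 := continuous_subtype_val.comp j.continuous
  have hmA : ∀ x ω, (i x).1 = ω → ω ∈ d.carrier → x ∈ A := fun x ω h hω => by
    change (i x).1 ∈ d.carrier
    rwa [h]
  have hmB : ∀ y ω, (j y).1 = ω → ω ∈ c.carrier → y ∈ B := fun y ω h hω => by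
    change (j y).1 ∈ c.carrier
    rwa [h]
  have hij : ∀ x (hx : x ∈ A), (j (j.symm ⟨(i x).1, hx⟩)).1 = (i x).1 := fun x hx => by
    rw [j.apply_symm_apply]
  have hji : ∀ y (hy : y ∈ B), (i (i.symm ⟨(j y).1, hy⟩)).1 = (j y).1 := fun y hy => by
    rw [i.apply_symm_apply]
  have hA : ∀ (x : (c.system.{u₁, u₂, v} G).Space) (hx : x ∈ A) (g : G), g • x ∈ A →
      (j (c.toFun (g • (i x).1) • j.symm ⟨(i x).1, hx⟩)).1 = (i (g • x)).1 := fun x hx g hg =>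
    coe_homeo_smul_toFun c d (hij x hx) hg
  have hB : ∀ (y : (d.system.{u₂, u₁, w} H).Space) (hy : y ∈ B) (h : H), h • y ∈ B →
      (i (d.toFun (h • (j y).1) • i.symm ⟨(j y).1, hy⟩)).1 = (j (h • y)).1 := fun y hy h hh =>
    coe_homeo_smul_toFun d c (hji y hy) hh
  have hsmulG : Continuous fun p : G × Ω => p.1 • p.2 :=
    continuous_prod_of_discrete_left.2 fun g => continuous_const_smul g
  have hsmulH : Continuous fun p : H × Ω => p.1 • p.2 :=
    continuous_prod_of_discrete_left.2 fun g => continuous_const_smul g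
  refine ⟨A, B, d.isClopen_carrier.preimage hi, c.isClopen_carrier.preimage hj, fun x => ?_,
    fun y => ?_, ⟨⟨⟨⟨fun x => ⟨j.symm ⟨(i x.1).1, x.2⟩, ?_⟩, fun y => ⟨i.symm ⟨(j y.1).1, y.2⟩, ?_⟩,
      fun x => ?_, fun y => ?_⟩, ?_, ?_⟩,
    ⟨⟨fun γ => ⟨(c.toFun (γ.1.1 • (i γ.1.2).1), j.symm ⟨(i γ.1.2).1, γ.2.1⟩), ?_, ?_⟩,
      fun γ => ⟨(d.toFun (γ.1.1 • (j γ.1.2).1), i.symm ⟨(j γ.1.2).1, γ.2.1⟩), ?_, ?_⟩,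
      fun γ => ?_, fun γ => ?_⟩, ?_, ?_⟩, fun γ => ?_, fun γ => ?_, fun γ δ h => ?_⟩⟩⟩
  · obtain ⟨g, h, hc, hd⟩ := hfull (i x).1
    rw [smul_comm] at hc
    refine ⟨g⁻¹, g • x, ?_, inv_smul_smul g x⟩
    refine hmA _ _ (c.coe_homeo_smul g x) ?_
    rwa [c.toFun_smul_eq hc, smul_comm]
  · obtain ⟨g, h, hc, hd⟩ := hfull (j y).1
    refine ⟨h⁻¹, h • y, ?_, inv_smul_smul h y⟩
    refine hmB _ _ (d.coe_homeo_smul h y) ?_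
    rwa [d.toFun_smul_eq hd]
  · exact hmB _ _ (hij _ x.2) (i x.1).2
  · exact hmA _ _ (hji _ y.2) (j y.1).2
  · exact Subtype.ext (i.injective (Subtype.ext ((hji _ _).trans (hij _ x.2))))
  · exact Subtype.ext (j.injective (Subtype.ext ((hij _ _).trans (hji _ y.2))))
  · exact (j.symm.continuous.comp ((hi.comp continuous_subtype_val).subtype_mk _)).subtype_mk _
  · exact (i.symm.continuous.comp ((hj.comp continuous_subtype_val).subtype_mk _)).subtype_mk _
  · exact hmB _ _ (hij _ γ.2.1) (i γ.1.2).2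
  · exact hmB _ _ (hA _ γ.2.1 _ γ.2.2) (i _).2
  · exact hmA _ _ (hji _ γ.2.1) (j γ.1.2).2
  · exact hmA _ _ (hB _ γ.2.1 _ γ.2.2) (j _).2
  · refine Subtype.ext (Prod.ext ?_ (i.injective (Subtype.ext ((hji _ _).trans (hij _ γ.2.1)))))
    refine (congrArg (fun ω => d.toFun (c.toFun (γ.1.1 • (i γ.1.2).1) • ω)) (hij _ γ.2.1)).trans
      (c.toFun_smul_toFun_smul d ?_)
    rw [← c.coe_homeo_smul γ.1.1 γ.1.2]
    exact γ.2.2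
  · refine Subtype.ext (Prod.ext ?_ (j.injective (Subtype.ext ((hij _ _).trans (hji _ γ.2.1)))))
    refine (congrArg (fun ω => c.toFun (d.toFun (γ.1.1 • (j γ.1.2).1) • ω)) (hji _ γ.2.1)).trans
      (d.toFun_smul_toFun_smul c ?_)
    rw [← d.coe_homeo_smul γ.1.1 γ.1.2]
    exact γ.2.2
  · have h1 := continuous_fst.comp (continuous_subtype_val (p := fun γ : G × _ =>
      γ.2 ∈ A ∧ γ.1 • γ.2 ∈ A))
    have h2 := hi.comp (continuous_snd.comp (continuous_subtype_val (p := fun γ : G × _ =>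
      γ.2 ∈ A ∧ γ.1 • γ.2 ∈ A)))
    exact ((c.continuous_toFun.comp (hsmulG.comp (h1.prodMk h2))).prodMk
      (j.symm.continuous.comp (h2.subtype_mk _))).subtype_mk _
  · have h1 := continuous_fst.comp (continuous_subtype_val (p := fun γ : H × _ =>
      γ.2 ∈ B ∧ γ.1 • γ.2 ∈ B))
    have h2 := hj.comp (continuous_snd.comp (continuous_subtype_val (p := fun γ : H × _ =>
      γ.2 ∈ B ∧ γ.1 • γ.2 ∈ B)))
    exact ((d.continuous_toFun.comp (hsmulH.comp (h1.prodMk h2))).prodMk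
      (i.symm.continuous.comp (h2.subtype_mk _))).subtype_mk _
  · rfl
  · refine Subtype.ext (j.injective (Subtype.ext ?_))
    exact (hA _ γ.2.1 _ γ.2.2).trans (hij _ γ.2.2).symm
  · refine Subtype.ext (Prod.ext ?_ rfl)
    have h' : γ.1.2 = δ.1.1 • δ.1.2 := congrArg Subtype.val h
    change c.toFun ((γ.1.1 * δ.1.1) • (i δ.1.2).1) =
      c.toFun (γ.1.1 • (i γ.1.2).1) * c.toFun (δ.1.1 • (i δ.1.2).1)
    rw [h', c.coe_homeo_smul δ.1.1 δ.1.2, smul_comm γ.1.1 (c.toFun _), c.map_smul, inv_mul_cancel_right,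
      mul_smul]

/-- If the two transversals coincide, the resulting systems have the same orbits. -/
theorem continuouslyOrbitEquivalent_system (c : Transversal H Ω) (d : Transversal G Ω)
    (hcd : c.carrier = d.carrier) :
    (c.system.{u₁, u₂, v} G).ContinuouslyOrbitEquivalent (d.system.{u₂, u₁, w} H) := by
  let i := c.homeo.{u₁, u₂, v} G
  let j := d.homeo.{u₂, u₁, w} H
  have hsmulG : Continuous fun p : G × Ω => p.1 • p.2 :=
    continuous_prod_of_discrete_left.2 fun g => continuous_const_smul g
  have hsmulH : Continuous fun p : H × Ω => p.1 • p.2 :=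
    continuous_prod_of_discrete_left.2 fun g => continuous_const_smul g
  let e : (c.system.{u₁, u₂, v} G).Space ≃ₜ (d.system.{u₂, u₁, w} H).Space :=
    i.trans ((Homeomorph.setCongr hcd).trans j.symm)
  have he : ∀ x, (j (e x)).1 = (i x).1 := fun x =>
    congrArg Subtype.val (j.apply_symm_apply _)
  have he' : ∀ y, (i (e.symm y)).1 = (j y).1 := fun y => by
    rw [← he, e.apply_symm_apply]
  refine ⟨e, e.symm, ⟨e.continuous, fun p => c.toFun (p.1 • (i p.2).1), ?_, fun g x => ?_⟩,
    ⟨e.symm.continuous, fun p => d.toFun (p.1 • (j p.2).1), ?_, fun h y => ?_⟩,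
    e.symm_apply_apply, e.apply_symm_apply⟩
  · exact c.continuous_toFun.comp (hsmulG.comp (continuous_fst.prodMk
      (continuous_subtype_val.comp (i.continuous.comp continuous_snd))))
  · refine j.injective (Subtype.ext ((he _).trans (coe_homeo_smul_toFun c d (he x) ?_).symm))
    rw [← hcd]
    exact (i _).2
  · exact d.continuous_toFun.comp (hsmulH.comp (continuous_fst.prodMk
      (continuous_subtype_val.comp (j.continuous.comp continuous_snd))))
  · refine i.injective (Subtype.ext ((he' _).trans (coe_homeo_smul_toFun d c (he' y) ?_).symm))
    rw [hcd]
    exact (j _).2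

end Coupling

/-! ### A topologically free action on a Cantor space -/

/-- The space on which `G × H` acts by shifting the first two coordinates. The additional
coordinate in `ℕ` makes the action topologically free also when `G` and `H` are finite. -/
def ShiftSpace (G H : Type*) : Type _ :=
  G × H × ℕ → Bool

namespace ShiftSpace

variable {G H : Type*}

instance : TopologicalSpace (ShiftSpace G H) := inferInstanceAs (TopologicalSpace (_ → _))
instance : T2Space (ShiftSpace G H) := inferInstanceAs (T2Space (_ → _))
instance : CompactSpace (ShiftSpace G H) := inferInstanceAs (CompactSpace (_ → _))
instance : TotallyDisconnectedSpace (ShiftSpace G H) :=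
  inferInstanceAs (TotallyDisconnectedSpace (_ → _))
instance [Countable G] [Countable H] : SecondCountableTopology (ShiftSpace G H) :=
  inferInstanceAs (SecondCountableTopology (_ → _))
instance [Countable G] [Countable H] : Small.{v} (ShiftSpace G H) :=
  inferInstanceAs (Small.{v} (_ → _))
instance : Nonempty (ShiftSpace G H) := inferInstanceAs (Nonempty (_ → _))

variable [Group G] [Group H]

instance : MulAction G (ShiftSpace G H) where
  smul g z := fun p => z (p.1 * g, p.2)
  one_smul z := funext fun p => congrArg z (by simp)
  mul_smul g g' z := funext fun p => congrArg z (by simp [mul_assoc])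

instance : MulAction H (ShiftSpace G H) where
  smul h z := fun p => z (p.1, p.2.1 * h, p.2.2)
  one_smul z := funext fun p => congrArg z (by simp)
  mul_smul h h' z := funext fun p => congrArg z (by simp [mul_assoc])

theorem smul_smul_apply (g : G) (h : H) (z : ShiftSpace G H) (p : G × H × ℕ) :
    (g • h • z) p = z (p.1 * g, p.2.1 * h, p.2.2) :=
  rfl

instance : SMulCommClass G H (ShiftSpace G H) := ⟨fun _ _ _ => rfl⟩
instance : SMulCommClass H G (ShiftSpace G H) := ⟨fun _ _ _ => rfl⟩
instance : ContinuousConstSMul G (ShiftSpace G H) :=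
  ⟨fun _ => continuous_pi fun _ => continuous_apply (A := fun _ => Bool) _⟩
instance : ContinuousConstSMul H (ShiftSpace G H) :=
  ⟨fun _ => continuous_pi fun _ => continuous_apply (A := fun _ => Bool) _⟩

theorem dense_smul_ne {g : G} {h : H} (hgh : (g, h) ≠ 1) :
    Dense {z : ShiftSpace G H | g • h • z ≠ z} := by
  classical
  refine dense_iff_inter_open.2 fun U hU ⟨z, hz⟩ => ?_
  obtain ⟨I, u, hu, hIU⟩ := isOpen_pi_iff.1 hU z hz
  -- Modify `z` only at a level that the open set does not see.
  obtain ⟨n, hn⟩ := Infinite.exists_notMem_finset (I.image fun p => p.2.2)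
  let z' : ShiftSpace G H := fun p => if p.2.2 = n then decide (p = (1, 1, n)) else z p
  refine ⟨z', hIU fun p hp => ?_, fun h => ?_⟩
  · have : p.2.2 ≠ n := fun h => hn (Finset.mem_image.2 ⟨p, hp, h⟩)
    simpa only [z', if_neg this] using (hu p hp).2
  · have := congrFun h (1, 1, n)
    rw [smul_smul_apply] at this
    simp only [z', one_mul, if_true, decide_true, decide_eq_true_eq, Prod.mk.injEq] at this
    exact hgh (Prod.ext this.1 this.2.1)

end ShiftSpace

/-! ### The orbit closure of a labelled coarse embedding -/

/-- A coarse embedding `G → H` with labels in `G` that separate the points of its fibres. The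
labels take finitely many values, and every fibre contains a point labelled `1`. -/
structure IsLabelledEmbedding {G H : Type*} [Group G] [Group H] (φ : G → H × G) : Prop where
  coarse : IsCoarseEmbedding fun s => (φ s).1
  injective : Function.Injective φ
  finite_labels : (range fun s => (φ s).2).Finite
  exists_label_one : ∀ s, ∃ t, φ t = ((φ s).1, 1)

/-- Label `s` by its quotient with a chosen point of its fibre. -/
theorem IsCoarseEmbedding.exists_isLabelledEmbedding {G H : Type*} [Group G] [Group H]
    {φ : G → H} (hφ : IsCoarseEmbedding φ) :
    ∃ l : G → G, IsLabelledEmbedding (fun s => (φ s, l s)) ∧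
      (Function.Injective φ → ∀ s, l s = 1) := by
  have hσ : ∀ s, φ (Function.invFun φ (φ s)) = φ s := fun s => Function.invFun_eq ⟨s, rfl⟩
  refine ⟨fun s => s * (Function.invFun φ (φ s))⁻¹, ⟨hφ, fun s t hst => ?_, ?_, fun s => ?_⟩,
    fun h s => ?_⟩
  · obtain ⟨h1, h2⟩ := Prod.mk.inj hst
    simp only [h1] at h2
    exact mul_right_cancel h2
  · refine (hφ.finite_translations 1).subset ?_
    rintro _ ⟨s, rfl⟩
    exact ⟨Function.invFun φ (φ s), by simp [hσ]⟩
  · exact ⟨Function.invFun φ (φ s), by simp [hσ]⟩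
  · simp only [h (hσ s), mul_inv_cancel]

/-- The closure of the orbit of `φ` in the space of maps `G → H × G`, where `G` acts by right
translation of the argument and `H` by right multiplication on the values. Membership of `f` says
that `f` agrees with a point of the orbit on every finite set. -/
def hull {G H : Type*} [Group G] [Group H] (φ : G → H × G) : Set (G → H × G) :=
  {f | ∀ S : Finset G, ∃ (g : G) (h : H), ∀ s ∈ S, f s = ((φ (s * g)).1 * h, (φ (s * g)).2)}

namespace hull

variable {G H : Type*} [Group G] [Group H] {φ : G → H × G}

theorem self_mem : φ ∈ hull φ := fun _ => ⟨1, 1, fun _ _ => by simp⟩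

instance : MulAction G (hull φ) where
  smul g f := ⟨fun s => f.1 (s * g), fun S => by
    classical
    obtain ⟨k, h, hf⟩ := f.2 (S.image (· * g))
    refine ⟨g * k, h, fun s hs => ?_⟩
    simp only [hf _ (Finset.mem_image_of_mem _ hs), mul_assoc]⟩
  one_smul f := Subtype.ext (funext fun s => congrArg f.1 (mul_one s))
  mul_smul g g' f := Subtype.ext (funext fun s => congrArg f.1 (mul_assoc s g g').symm)

instance : MulAction H (hull φ) where
  smul h f := ⟨fun s => ((f.1 s).1 * h⁻¹, (f.1 s).2), fun S => by
    obtain ⟨g, k, hf⟩ := f.2 S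
    refine ⟨g, k * h⁻¹, fun s hs => ?_⟩
    simp only [hf _ hs, mul_assoc]⟩
  one_smul f := Subtype.ext (funext fun s => Prod.ext (by
    change (f.1 s).1 * 1⁻¹ = _
    simp) rfl)
  mul_smul h h' f := Subtype.ext (funext fun s => Prod.ext (by
    change (f.1 s).1 * (h * h')⁻¹ = (f.1 s).1 * h'⁻¹ * h⁻¹
    simp [mul_assoc]) rfl)

theorem smul_apply (g : G) (f : hull φ) (s : G) : (g • f).1 s = f.1 (s * g) := rfl

theorem smul_apply' (h : H) (f : hull φ) (s : G) :
    (h • f).1 s = ((f.1 s).1 * h⁻¹, (f.1 s).2) := rfl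

instance : SMulCommClass G H (hull φ) := ⟨fun _ _ _ => rfl⟩
instance : SMulCommClass H G (hull φ) := ⟨fun _ _ _ => rfl⟩

theorem exists_quotient_eq (f : hull φ) (s t : G) :
    (f.1 s).1 * (f.1 t).1⁻¹ ∈ range fun v => (φ (s * t⁻¹ * v)).1 * (φ v).1⁻¹ := by
  classical
  obtain ⟨g, h, hf⟩ := f.2 {s, t}
  refine ⟨t * g, ?_⟩
  rw [hf s (by simp), hf t (by simp)]
  simp [mul_assoc]

theorem label_mem (f : hull φ) (s : G) : (f.1 s).2 ∈ range fun s => (φ s).2 := by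
  obtain ⟨g, h, hf⟩ := f.2 {s}
  exact ⟨s * g, by rw [hf s (by simp)]⟩

theorem injective (hφ : IsLabelledEmbedding φ) (f : hull φ) : Function.Injective f.1 := by
  classical
  intro s t hst
  obtain ⟨g, h, hf⟩ := f.2 {s, t}
  rw [hf s (by simp), hf t (by simp), Prod.mk.injEq] at hst
  exact mul_right_cancel (hφ.injective (Prod.ext (mul_right_cancel hst.1) hst.2))

theorem exists_label_one (hφ : IsLabelledEmbedding φ) (f : hull φ) (s : G) :
    ∃ t, f.1 t = ((f.1 s).1, 1) := by
  classical
  have hT := hφ.coarse.finite_translations 1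
  obtain ⟨g, h, hf⟩ := f.2 (insert s (hT.toFinset.image (· * s)))
  obtain ⟨t, ht⟩ := hφ.exists_label_one (s * g)
  have hr : t * (s * g)⁻¹ ∈ hT.toFinset := by
    rw [Finite.mem_toFinset]
    exact ⟨s * g, by rw [inv_mul_cancel_right, ht, mul_inv_cancel]⟩
  refine ⟨t * (s * g)⁻¹ * s, ?_⟩
  rw [hf _ (Finset.mem_insert_of_mem (Finset.mem_image_of_mem _ hr)),
    hf s (Finset.mem_insert_self _ _), show t * (s * g)⁻¹ * s * g = t by group, ht]

/-- Coarse surjectivity passes to the orbit closure. -/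
theorem exists_mem_of_finite (hφ : IsLabelledEmbedding φ) {L : Set H} (hL : L.Finite)
    (hφL : ∀ y, ∃ s, (φ s).1 * y⁻¹ ∈ L) (f : hull φ) : ∃ s, (f.1 s).1 ∈ L := by
  classical
  -- Only finitely many `s` can satisfy the conclusion, given the value of `f` at `1`.
  have hT : (⋃ l ∈ L, {r : G | ∃ v, (φ (r * v)).1 * (φ v).1⁻¹ = l * (f.1 1).1⁻¹}).Finite :=
    hL.biUnion fun l _ => hφ.coarse.finite_translations _
  obtain ⟨g, h, hf⟩ := f.2 (insert 1 hT.toFinset)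
  obtain ⟨s, hs⟩ := hφL h⁻¹
  rw [inv_inv] at hs
  have h1 := hf 1 (Finset.mem_insert_self _ _)
  have hr : s * g⁻¹ ∈ hT.toFinset := by
    simp only [Finite.mem_toFinset, mem_iUnion, mem_ofPred_eq, exists_prop]
    exact ⟨_, hs, g, by simp [h1, mul_assoc]⟩
  refine ⟨s * g⁻¹, ?_⟩
  rw [hf _ (Finset.mem_insert_of_mem hr), inv_mul_cancel_right]
  exact hs

variable [TopologicalSpace G] [DiscreteTopology G] [TopologicalSpace H] [DiscreteTopology H]

theorem isClosed : IsClosed (hull φ) := by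
  have : hull φ = ⋂ S : Finset G, S.restrict ⁻¹'
      {f : S → H × G | ∃ (g : G) (h : H), ∀ s, f s = ((φ (s * g)).1 * h, (φ (s * g)).2)} := by
    ext f
    simp [hull]
  rw [this]
  refine isClosed_iInter fun S => IsClosed.preimage ?_ (isClosed_discrete _)
  exact continuous_pi fun s => continuous_apply s.1

instance : ContinuousConstSMul G (hull φ) :=
  ⟨fun g => continuous_induced_rng.2 (continuous_pi fun s =>
    (continuous_apply (s * g)).comp continuous_subtype_val)⟩

instance : ContinuousConstSMul H (hull φ) :=
  ⟨fun h => continuous_induced_rng.2 (continuous_pi fun s =>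
    (continuous_of_discreteTopology (f := fun p : H × G => (p.1 * h⁻¹, p.2))).comp
      ((continuous_apply s).comp continuous_subtype_val))⟩

omit [DiscreteTopology G] [DiscreteTopology H] in
theorem continuous_apply (s : G) : Continuous fun f : hull φ => f.1 s :=
  (_root_.continuous_apply s).comp continuous_subtype_val

/-- The transversal for `H` of the maps with value `1` at `1`. -/
def transversal (φ : G → H × G) : Transversal H (hull φ) where
  toFun f := (f.1 1).1
  continuous_toFun := continuous_fst.comp (continuous_apply 1)
  map_smul _ _ := rfl

theorem isCompact_fiber (hφ : IsLabelledEmbedding φ) (y : H) :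
    IsCompact {f : hull φ | (f.1 1).1 = y} := by
  have hK : IsCompact (univ.pi fun s : G =>
      ((· * y) '' range fun v => (φ (s * v)).1 * (φ v).1⁻¹) ×ˢ range fun s => (φ s).2) :=
    isCompact_univ_pi fun s =>
      (((hφ.coarse.finite_quotients s).image _).prod hφ.finite_labels).isCompact
  refine ((hull.isClosed (φ := φ)).isClosedEmbedding_subtypeVal.isCompact_preimage
    hK).of_isClosed_subset ((isClosed_discrete {y}).preimage
      (continuous_fst.comp (continuous_apply 1))) fun f hf s _ => ⟨?_, label_mem f s⟩
  have := exists_quotient_eq f s 1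
  rw [inv_one, mul_one, show (f.1 1).1 = y from hf] at this
  exact ⟨_, this, by simp⟩

theorem locallyCompactSpace (hφ : IsLabelledEmbedding φ) : LocallyCompactSpace (hull φ) := by
  have : WeaklyLocallyCompactSpace (hull φ) := ⟨fun f => ⟨_, isCompact_fiber hφ (f.1 1).1,
    (isOpen_discrete {(f.1 1).1}).preimage (continuous_fst.comp (continuous_apply 1)) |>.mem_nhds
      rfl⟩⟩
  infer_instance

theorem isCompact_carrier_transversal (hφ : IsLabelledEmbedding φ) :
    IsCompact (transversal φ).carrier :=
  isCompact_fiber hφ 1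

omit [TopologicalSpace G] [DiscreteTopology G] [TopologicalSpace H] [DiscreteTopology H] in
theorem argmin_eq_iff (hφ : IsLabelledEmbedding φ) {ν : H × G → ℕ} (hν : Function.Injective ν)
    (f : hull φ) (s : G) :
    Function.argmin (fun s => ν (f.1 s)) = s ↔ ∀ t, ν (f.1 s) ≤ ν (f.1 t) := by
  refine ⟨?_, fun h => injective hφ f (hν (le_antisymm
    (Function.argmin_le (fun s => ν (f.1 s)) s) (h _)))⟩
  rintro rfl t
  exact Function.argmin_le (fun s => ν (f.1 s)) t

/-- The transversal for `G` of the maps that take their least value at `1`, with respect to an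
enumeration of the set of values. -/
noncomputable def minTransversal (hφ : IsLabelledEmbedding φ) {ν : H × G → ℕ}
    (hν : Function.Injective ν) : Transversal G (hull φ) where
  toFun f := Function.argmin fun s => ν (f.1 s)
  continuous_toFun := by
    refine continuous_discrete_rng.2 fun s => isOpen_iff_mem_nhds.2 fun f hf => ?_
    rw [mem_preimage, mem_singleton_iff, argmin_eq_iff hφ hν] at hf
    -- Given `f s`, a value below it can only be taken at points of a finite set `T`.
    have hT : (⋃ p ∈ {p : H × G | ν p < ν (f.1 s)},
        (· * s) '' {r : G | ∃ v, (φ (r * v)).1 * (φ v).1⁻¹ = p.1 * (f.1 s).1⁻¹}).Finite :=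
      ((finite_lt_nat _).preimage hν.injOn).biUnion fun p _ =>
        (hφ.coarse.finite_translations _).image _
    have hev : ∀ t, ∀ᶠ f' : hull φ in 𝓝 f, f'.1 t = f.1 t := fun t =>
      (continuous_apply t).continuousAt.eventually ((isOpen_discrete {f.1 t}).mem_nhds rfl)
    filter_upwards [hev s, (eventually_all_finite hT).2 fun t _ => hev t] with f' hs hT'
    rw [mem_preimage, mem_singleton_iff, argmin_eq_iff hφ hν]
    refine fun t => not_lt.1 fun hlt => hlt.not_ge ?_
    have htT : t ∈ ⋃ p ∈ {p : H × G | ν p < ν (f.1 s)},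
        (· * s) '' {r : G | ∃ v, (φ (r * v)).1 * (φ v).1⁻¹ = p.1 * (f.1 s).1⁻¹} := by
      simp only [mem_iUnion]
      exact ⟨f'.1 t, by rwa [hs] at hlt, t * s⁻¹, by
        rw [← hs]
        exact exists_quotient_eq f' t s, inv_mul_cancel_right t s⟩
    rw [hs, hT' t htT]
    exact hf t
  map_smul g f := by
    rw [argmin_eq_iff hφ hν]
    intro t
    rw [smul_apply, smul_apply, inv_mul_cancel_right]
    exact (argmin_eq_iff hφ hν f _).1 rfl _

theorem mem_carrier_minTransversal (hφ : IsLabelledEmbedding φ) {ν : H × G → ℕ}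
    (hν : Function.Injective ν) {f : hull φ} :
    f ∈ (minTransversal hφ hν).carrier ↔ ∀ t, ν (f.1 1) ≤ ν (f.1 t) :=
  argmin_eq_iff hφ hν f 1

theorem isCompact_carrier_minTransversal (hφ : IsLabelledEmbedding φ) {ν : H × G → ℕ}
    (hν : Function.Injective ν) {L : Set H} (hL : L.Finite)
    (hφL : ∀ y, ∃ s, (φ s).1 * y⁻¹ ∈ L) : IsCompact (minTransversal hφ hν).carrier := by
  obtain ⟨N, hN⟩ := ((hL.prod hφ.finite_labels).image ν).bddAbove
  have hF : (Prod.fst '' {p : H × G | ν p ≤ N}).Finite :=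
    ((finite_le_nat N).preimage hν.injOn).image _
  refine (hF.isCompact_biUnion fun y _ => isCompact_fiber hφ y).of_isClosed_subset
    (minTransversal hφ hν).isClopen_carrier.isClosed fun f hf => ?_
  obtain ⟨s, hs⟩ := exists_mem_of_finite hφ hL hφL f
  simp only [mem_iUnion]
  exact ⟨(f.1 1).1, ⟨f.1 1, ((mem_carrier_minTransversal hφ hν).1 hf s).trans
    (hN ⟨_, ⟨hs, label_mem f s⟩, rfl⟩), rfl⟩, rfl⟩

end hull

/-! ### From coarse embeddings to dynamical systems -/

/-- Pull back a transversal to a product. -/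
def Transversal.prodFst {H Ω Z : Type*} [Group H] [TopologicalSpace H] [MulAction H Ω]
    [TopologicalSpace Ω] [MulAction H Z] [TopologicalSpace Z] (c : Transversal H Ω) :
    Transversal H (Ω × Z) where
  toFun ω := c.toFun ω.1
  continuous_toFun := c.continuous_toFun.comp continuous_fst
  map_smul h ω := c.map_smul h ω.1

theorem Transversal.isCompact_carrier_prodFst {H Ω Z : Type*} [Group H] [TopologicalSpace H]
    [MulAction H Ω] [TopologicalSpace Ω] [MulAction H Z] [TopologicalSpace Z] [CompactSpace Z]
    {c : Transversal H Ω} (hc : IsCompact c.carrier) :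
    IsCompact (c.prodFst (Z := Z)).carrier := by
  convert hc.prod (isCompact_univ (X := Z)) using 1
  ext ω
  simp [carrier, prodFst]

open TopDynSystem

section

variable {G : Type u₁} {H : Type u₂} [Group G] [Countable G] [TopologicalSpace G]
  [DiscreteTopology G] [Group H] [Countable H] [TopologicalSpace H] [DiscreteTopology H]

/-- A coarse embedding gives Kakutani equivalent systems on transversals of the orbit closure of
`φ`, multiplied by a topologically free Cantor system. -/
theorem IsCoarseEmbedding.exists_systems {φ : G → H} (hφ : IsCoarseEmbedding φ) :
    ∃ (X : TopDynSystem.{u₁, v} G) (Y : TopDynSystem.{u₂, w} H),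
      Nonempty X.Space ∧ X.IsTopFree ∧ Y.IsTopFree ∧ CompactSpace X.Space ∧
      X.IsTotDiscSecondCountable ∧ Y.IsTotDiscSecondCountable ∧ X.KakutaniEquivalent Y ∧
      (∀ L : Set H, L.Finite → (∀ y, ∃ s, φ s * y⁻¹ ∈ L) → CompactSpace Y.Space) ∧
      (Function.Bijective φ → X.ContinuouslyOrbitEquivalent Y) := by
  classical
  obtain ⟨l, hl, hl1⟩ := hφ.exists_isLabelledEmbedding
  set Φ : G → H × G := fun s => (φ s, l s)
  -- An enumeration of the values starting with the identity.
  obtain ⟨ν, hν, hν1⟩ : ∃ ν : H × G → ℕ, Function.Injective ν ∧ ν 1 = 0 := by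
    obtain ⟨ν, hν⟩ := exists_injective_nat (H × G)
    refine ⟨fun p => if p = 1 then 0 else ν p + 1, fun p q h => ?_, if_pos rfl⟩
    by_cases hp : p = 1 <;> by_cases hq : q = 1 <;> simp [hp, hq] at h ⊢
    exact hν h
  have := hull.locallyCompactSpace hl
  let Ω := hull Φ × ShiftSpace G H
  have hv : Small.{v} Ω := inferInstance
  have hw : Small.{w} Ω := inferInstance
  let c : Transversal H Ω := (hull.transversal Φ).prodFst
  let d : Transversal G Ω := (hull.minTransversal hl hν).prodFst
  have hfree : ∀ (g : G) (h : H), (g, h) ≠ 1 → Dense {ω : Ω | g • h • ω ≠ ω} := fun g h hgh =>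
    ((ShiftSpace.dense_smul_ne hgh).preimage isOpenMap_snd).mono
      fun ω (hω : g • h • ω.2 ≠ ω.2) h' => hω (congrArg Prod.snd h')
  refine ⟨c.system.{u₁, u₂, v} G, d.system.{u₂, u₁, w} H, ?_, ?_, ?_, ?_, ?_, ?_, ?_, fun L hL hφL => ?_, fun hbij => ?_⟩
  · obtain ⟨z⟩ : Nonempty (ShiftSpace G H) := inferInstance
    exact ⟨(c.homeo.{u₁, u₂, v} G).symm ⟨_, c.smul_mem_carrier (⟨Φ, hull.self_mem⟩, z)⟩⟩
  · refine Transversal.isTopFree_system.{v} (fun g h hg => ?_) c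
    simp only [smul_comm h g]
    exact hfree g h fun h => hg (Prod.mk.inj h).1
  · exact Transversal.isTopFree_system.{w} (fun h g hh => hfree g h fun h => hh (Prod.mk.inj h).2) d
  · exact c.compactSpace_system.{v}
      (Transversal.isCompact_carrier_prodFst (hull.isCompact_carrier_transversal hl))
  · exact c.isTotDiscSecondCountable_system.{v}
  · exact d.isTotDiscSecondCountable_system.{w}
  · refine kakutaniEquivalent_system.{u₁, u₂, v, w} c d fun ω => ?_
    obtain ⟨t, ht⟩ := hull.exists_label_one hl ω.1 1
    have h1 : (t • (ω.1.1 1).1 • ω.1).1 1 = 1 := by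
      rw [hull.smul_apply, hull.smul_apply', one_mul, ht, mul_inv_cancel]
      rfl
    refine ⟨t, (ω.1.1 1).1, congrArg Prod.fst h1, ?_⟩
    refine (hull.mem_carrier_minTransversal hl hν).2 fun s => ?_
    change ν ((t • (ω.1.1 1).1 • ω.1).1 1) ≤ _
    rw [h1, hν1]
    exact Nat.zero_le _
  · exact d.compactSpace_system.{w} (Transversal.isCompact_carrier_prodFst
      (hull.isCompact_carrier_minTransversal hl hν hL hφL))
  · refine continuouslyOrbitEquivalent_system.{u₁, u₂, v, w} c d (Set.ext fun ω => ?_)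
    have hlabel : ∀ s, (ω.1.1 s).2 = 1 := fun s => by
      obtain ⟨t, ht⟩ := hull.label_mem ω.1 s
      exact ht.symm.trans (hl1 hbij.1 t)
    have hd : ω ∈ d.carrier ↔ ∀ t, ν (ω.1.1 1) ≤ ν (ω.1.1 t) :=
      hull.mem_carrier_minTransversal hl hν
    rw [hd]
    refine ⟨fun hω t => ?_, fun hω => ?_⟩
    · rw [show ω.1.1 1 = 1 from Prod.ext hω (hlabel 1), hν1]
      exact Nat.zero_le _
    · obtain ⟨s, hs⟩ := hull.exists_mem_of_finite hl (finite_singleton (1 : H)) (fun y => by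
        obtain ⟨s, rfl⟩ := hbij.2 y
        exact ⟨s, mul_inv_cancel _⟩) ω.1
      have h1 : ν (ω.1.1 s) = 0 := by
        rw [show ω.1.1 s = 1 from Prod.ext hs (hlabel s), hν1]
      have h2 : ω.1.1 1 = 1 := hν (by rw [hν1, ← Nat.le_zero, ← h1]; exact hω s)
      exact congrArg Prod.fst h2

theorem IsCoarseEquivalence.exists_systems {φ : G → H} (hφ : IsCoarseEquivalence φ) :
    ∃ (X : TopDynSystem.{u₁, v} G) (Y : TopDynSystem.{u₂, w} H),
      Nonempty X.Space ∧ X.IsTopFree ∧ Y.IsTopFree ∧ CompactSpace X.Space ∧ CompactSpace Y.Space ∧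
      X.IsTotDiscSecondCountable ∧ Y.IsTotDiscSecondCountable ∧ X.KakutaniEquivalent Y ∧
      (Function.Bijective φ → X.ContinuouslyOrbitEquivalent Y) := by
  obtain ⟨X, Y, h1, h2, h3, h4, h5, h6, h7, h8, h9⟩ := hφ.isCoarseEmbedding.exists_systems
  obtain ⟨-, ψ, -, -, hE⟩ := hφ
  exact ⟨X, Y, h1, h2, h3, h4, h8 _ hE fun y => ⟨ψ y, y, rfl⟩, h5, h6, h7, h9⟩

end

theorem theorem2 (G : Type u₁) (H : Type u₂)
    [Group G] [Countable G] [TopologicalSpace G] [DiscreteTopology G]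
    [Group H] [Countable H] [TopologicalSpace H] [DiscreteTopology H] :
    List.TFAE [
      ∃ φ : G → H, IsCoarseEmbedding φ,
      ∃ (X : TopDynSystem.{u₁, v} G) (Y : TopDynSystem.{u₂, w} H),
        Nonempty X.Space ∧ X.IsTopFree ∧ Y.IsTopFree ∧ CompactSpace X.Space ∧
        X.KakutaniEquivalent Y,
      ∃ (X : TopDynSystem.{u₁, v} G) (Y : TopDynSystem.{u₂, w} H),
        Nonempty X.Space ∧ X.IsTopFree ∧ Y.IsTopFree ∧ CompactSpace X.Space ∧
        ∃ p q, X.IsContinuousOrbitCouple Y p q,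
      ∃ (X : TopDynSystem.{u₁, v} G) (Y : TopDynSystem.{u₂, w} H),
        Nonempty X.Space ∧ X.IsTopFree ∧ Y.IsTopFree ∧ CompactSpace X.Space ∧
        X.IsTotDiscSecondCountable ∧ Y.IsTotDiscSecondCountable ∧
        X.KakutaniEquivalent Y,
      ∃ (X : TopDynSystem.{u₁, v} G) (Y : TopDynSystem.{u₂, w} H),
        Nonempty X.Space ∧ X.IsTopFree ∧ Y.IsTopFree ∧ CompactSpace X.Space ∧
        X.IsTotDiscSecondCountable ∧ Y.IsTotDiscSecondCountable ∧
        ∃ p q, X.IsContinuousOrbitCouple Y p q] ∧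
    List.TFAE [
      ∃ φ : G → H, IsCoarseEquivalence φ,
      ∃ (X : TopDynSystem.{u₁, v} G) (Y : TopDynSystem.{u₂, w} H),
        Nonempty X.Space ∧ X.IsTopFree ∧ Y.IsTopFree ∧
        CompactSpace X.Space ∧ CompactSpace Y.Space ∧
        X.KakutaniEquivalent Y,
      ∃ (X : TopDynSystem.{u₁, v} G) (Y : TopDynSystem.{u₂, w} H),
        Nonempty X.Space ∧ X.IsTopFree ∧ Y.IsTopFree ∧
        CompactSpace X.Space ∧ CompactSpace Y.Space ∧
        ∃ p q, X.IsContinuousOrbitCouple Y p q,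
      ∃ (X : TopDynSystem.{u₁, v} G) (Y : TopDynSystem.{u₂, w} H),
        Nonempty X.Space ∧ X.IsTopFree ∧ Y.IsTopFree ∧
        CompactSpace X.Space ∧ CompactSpace Y.Space ∧
        X.IsTotDiscSecondCountable ∧ Y.IsTotDiscSecondCountable ∧
        X.KakutaniEquivalent Y,
      ∃ (X : TopDynSystem.{u₁, v} G) (Y : TopDynSystem.{u₂, w} H),
        Nonempty X.Space ∧ X.IsTopFree ∧ Y.IsTopFree ∧
        CompactSpace X.Space ∧ CompactSpace Y.Space ∧
        X.IsTotDiscSecondCountable ∧ Y.IsTotDiscSecondCountable ∧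
        ∃ p q, X.IsContinuousOrbitCouple Y p q] ∧
    List.TFAE [
      ∃ φ : G → H, Function.Bijective φ ∧ IsCoarseEquivalence φ,
      ∃ (X : TopDynSystem.{u₁, v} G) (Y : TopDynSystem.{u₂, w} H),
        Nonempty X.Space ∧ X.IsTopFree ∧ Y.IsTopFree ∧
        CompactSpace X.Space ∧ CompactSpace Y.Space ∧
        X.ContinuouslyOrbitEquivalent Y,
      ∃ (X : TopDynSystem.{u₁, v} G) (Y : TopDynSystem.{u₂, w} H),
        Nonempty X.Space ∧ X.IsTopFree ∧ Y.IsTopFree ∧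
        CompactSpace X.Space ∧ CompactSpace Y.Space ∧
        X.IsTotDiscSecondCountable ∧ Y.IsTotDiscSecondCountable ∧
        X.ContinuouslyOrbitEquivalent Y] := by
  refine ⟨?_, ?_, ?_⟩
  · tfae_have 1 → 4 := by
      rintro ⟨φ, hφ⟩
      obtain ⟨X, Y, h1, h2, h3, h4, h5, h6, h7, -⟩ := hφ.exists_systems
      exact ⟨X, Y, h1, h2, h3, h4, h5, h6, h7⟩
    tfae_have 4 → 2 := by
      rintro ⟨X, Y, h1, h2, h3, h4, -, -, h7⟩
      exact ⟨X, Y, h1, h2, h3, h4, h7⟩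
    tfae_have 4 → 5 := by
      rintro ⟨X, Y, h1, h2, h3, h4, h5, h6, h7⟩
      exact ⟨X, Y, h1, h2, h3, h4, h5, h6, h7.exists_isContinuousOrbitCouple⟩
    tfae_have 2 → 3 := by
      rintro ⟨X, Y, h1, h2, h3, h4, h7⟩
      exact ⟨X, Y, h1, h2, h3, h4, h7.exists_isContinuousOrbitCouple⟩
    tfae_have 5 → 3 := by
      rintro ⟨X, Y, h1, h2, h3, h4, -, -, h7⟩
      exact ⟨X, Y, h1, h2, h3, h4, h7⟩
    tfae_have 3 → 1 := by
      rintro ⟨X, Y, _, h2, h3, _, p, q, h⟩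
      exact h.exists_isCoarseEmbedding h2 h3
    tfae_finish
  · tfae_have 1 → 4 := by
      rintro ⟨φ, hφ⟩
      obtain ⟨X, Y, h1, h2, h3, h4, h5, h6, h7, h8, -⟩ := hφ.exists_systems
      exact ⟨X, Y, h1, h2, h3, h4, h5, h6, h7, h8⟩
    tfae_have 4 → 2 := by
      rintro ⟨X, Y, h1, h2, h3, h4, h5, -, -, h8⟩
      exact ⟨X, Y, h1, h2, h3, h4, h5, h8⟩
    tfae_have 4 → 5 := by
      rintro ⟨X, Y, h1, h2, h3, h4, h5, h6, h7, h8⟩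
      exact ⟨X, Y, h1, h2, h3, h4, h5, h6, h7, h8.exists_isContinuousOrbitCouple⟩
    tfae_have 2 → 3 := by
      rintro ⟨X, Y, h1, h2, h3, h4, h5, h8⟩
      exact ⟨X, Y, h1, h2, h3, h4, h5, h8.exists_isContinuousOrbitCouple⟩
    tfae_have 5 → 3 := by
      rintro ⟨X, Y, h1, h2, h3, h4, h5, -, -, h8⟩
      exact ⟨X, Y, h1, h2, h3, h4, h5, h8⟩
    tfae_have 3 → 1 := by
      rintro ⟨X, Y, _, h2, h3, _, _, p, q, h⟩
      obtain ⟨φ, hφ, -⟩ := h.exists_isCoarseEquivalence h2 h3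
      exact ⟨φ, hφ⟩
    tfae_finish
  · tfae_have 1 → 3 := by
      rintro ⟨φ, hbij, hφ⟩
      obtain ⟨X, Y, h1, h2, h3, h4, h5, h6, h7, -, h8⟩ := hφ.exists_systems
      exact ⟨X, Y, h1, h2, h3, h4, h5, h6, h7, h8 hbij⟩
    tfae_have 3 → 2 := by
      rintro ⟨X, Y, h1, h2, h3, h4, h5, -, -, h8⟩
      exact ⟨X, Y, h1, h2, h3, h4, h5, h8⟩
    tfae_have 2 → 1 := by
      rintro ⟨X, Y, _, h2, h3, _, _, p, q, hp, hq, hqp, hpq⟩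
      obtain ⟨φ, hφ, hbij⟩ := (IsContinuousOrbitCouple.of_inverse hp hq hqp
        hpq).exists_isCoarseEquivalence h2 h3
      exact ⟨φ, hbij hqp hpq, hφ⟩
    tfae_finish
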